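/- Let $\mathcal H_1\neq 0$ and $\mathcal H_2$ be finite-dimensional complex Hilbert spaces with fixed orthonormal bases, let $X$ be a nonempty finite set, and let $\mathcal A$ and $\mathcal B_x$ ($x\in X$) be completely positive trace-preserving linear maps from the operators on $\mathcal H_1$ to the operators on $\mathcal H_2$. For a linear map $\Xi$ between these operator spaces put $J(\Xi)=\sum_{i,j}|i\rangle\langle j|\otimes\Xi(|i\rangle\langle j|)$. For Hermiticity-preserving $\Xi$ (such as a difference of two such channels) put $\|\Xi\|_\diamond=\max_\Phi\|(\Xi\otimes\mathrm{id})(\Phi)\|_1$, where $\Phi$ ranges over the pure states on $\mathcal H_1\otimes\mathbb C^n$, $n$ arbitrary, and $\|M\|_1=\operatorname{tr}\sqrt{MM^\dagger}$. For a function $p:X\to\mathbb R$ put $e(p)=\tfrac12\bigl\|\mathcal A-\sum_{x\in X}p(x)\mathcal B_x\bigr\|_\diamond$. Consider the following pair of semidefinite programs. Primal: maximize $\operatorname{tr}[J(\mathcal A)T]-t$ over operators $T$ on $\mathcal H_1\otimes\mathcal H_2$, $\rho$ on $\mathcal H_1$ and $t\in\mathbb R$, subject to $0\le T\le\rho\otimes\mathbb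 I_{\mathcal H_2}$, $\rho\ge0$, $\operatorname{tr}\rho=1$, and $\operatorname{tr}[J(\mathcal B_x)T]\le t$ for all $x\in X$. Dual: minimize $r\in\mathbb R$ over $r$, operators $S$ on $\mathcal H_1\otimes\mathcal H_2$ and $p:X\to\mathbb R$, subject to $S\ge0$, $S\ge J\bigl(\mathcal A-\sum_{x\in X}p(x)\mathcal B_x\bigr)$, $r\,\mathbb I_{\mathcal H_1}\ge\operatorname{tr}_{\mathcal H_2}S$, $p(x)\ge0$ for all $x\in X$, and $\sum_{x\in X}p(x)\le1$. Then the maximum defining $\|\mathcal A-\sum_x p(x)\mathcal B_x\|_\diamond$ is attained for every probability distribution $p$ on $X$. The minimum of $e(p)$ over all probability distributions $p$ on $X$, the maximum of the primal problem and the minimum of the dual problem are all attained and have the same value $v$ (in particular, strong duality holds). A probability distribution $p$ on $X$ satisfies $e(p)=v$ if and only if $(v,S,p)$ is feasible for the dual problem for some $S$, that is, if and only if $p$ is part of an optimal dual solution. Moreover, if $(v,S,p)$ is any optimal dual solution, then every probability distribution $q$ on $X$ with $q\ge p$ pointwise satisfies $e(q)=v$. -/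

import Mathlib

/-!
Finite-dimensional Hilbert spaces are modelled as `ℂ^d` for finite index types `d` (the
computational basis), linear operators on them as matrices, and `H₁ ⊗ H₂` is indexed by
`d₁ × d₂`. For matrices, `P ≥ Q` is written `(P - Q).PosSemidef`.
-/

open scoped Kronecker ComplexOrder

noncomputable section

namespace ChannelMixing

/-- Linear maps from operators on `ℂ^a` to operators on `ℂ^b`. -/
abbrev SuperOp (a b : Type*) := Matrix a a ℂ →ₗ[ℂ] Matrix b b ℂ

/-- `Ξ ⊗ id`, where `id` acts on the operators on `ℂ^e`. -/
def ampl {a b : Type*} (Ξ : SuperOp a b) (e : Type*) : SuperOp (a × e) (b × e) where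
  toFun M := Matrix.of fun u v => Ξ (Matrix.of fun i j => M (i, u.2) (j, v.2)) u.1 v.1
  map_add' M N := by
    ext u v
    exact congrFun (congrFun (map_add Ξ (Matrix.of fun i j => M (i, u.2) (j, v.2))
      (Matrix.of fun i j => N (i, u.2) (j, v.2))) u.1) v.1
  map_smul' c M := by
    ext u v
    exact congrFun (congrFun (map_smul Ξ c (Matrix.of fun i j => M (i, u.2) (j, v.2))) u.1) v.1

/-- On product operators, `Ξ ⊗ id` acts as `M ⊗ N ↦ Ξ M ⊗ N`. -/
theorem ampl_kronecker {a b e : Type*} (Ξ : SuperOp a b) (M : Matrix a a ℂ) (N : Matrix e e ℂ) :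
    ampl Ξ e (M ⊗ₖ N) = Ξ M ⊗ₖ N := by
  ext u v
  have h : (Matrix.of fun i j => (M ⊗ₖ N) (i, u.2) (j, v.2)) = N u.2 v.2 • M := by
    ext i j
    simp [Matrix.kroneckerMap_apply, mul_comm]
  change Ξ (Matrix.of fun i j => (M ⊗ₖ N) (i, u.2) (j, v.2)) u.1 v.1 = _
  rw [h]
  simp [Matrix.kroneckerMap_apply, mul_comm]

/-- Completely positive and trace preserving maps. -/
structure IsCPTP {a b : Type*} [Fintype a] [Fintype b] (Ξ : SuperOp a b) : Prop where
  completelyPositive : ∀ (n : ℕ) (M : Matrix (a × Fin n) (a × Fin n) ℂ),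
    M.PosSemidef → (ampl Ξ (Fin n) M).PosSemidef
  tracePreserving : ∀ M : Matrix a a ℂ, (Ξ M).trace = M.trace

/-- Quantum states (density operators). -/
def IsState {a : Type*} [Fintype a] (ρ : Matrix a a ℂ) : Prop :=
  ρ.PosSemidef ∧ ρ.trace = 1

/-- Pure quantum states. -/
def IsPureState {a : Type*} [Fintype a] (φ : Matrix a a ℂ) : Prop :=
  IsState φ ∧ (φ * φ).trace = 1

open scoped MatrixOrder in
/-- The trace norm `tr √(M Mᴴ)`. -/
def traceNorm {a : Type*} [Fintype a] [DecidableEq a] (M : Matrix a a ℂ) : ℝ :=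
  (CFC.sqrt (M * M.conjTranspose)).trace.re

/-- The trace norms of `(Ξ ⊗ id)(Φ)`, for pure states `Φ` on `ℂ^a ⊗ ℂ^n` with any `n`. -/
def outputTraceNorms {a b : Type*} [Fintype a] [Fintype b] [DecidableEq b]
    (Ξ : SuperOp a b) : Set ℝ :=
  {s | ∃ (n : ℕ) (Φ : Matrix (a × Fin n) (a × Fin n) ℂ),
    IsPureState Φ ∧ s = traceNorm (ampl Ξ (Fin n) Φ)}

/-- The diamond norm (of a difference of two CPTP maps, or more generally of a Hermitian-preserving
map): the maximum of the trace norm of `(Ξ ⊗ id)(Φ)` over pure states `Φ`. -/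
def diamondNorm {a b : Type*} [Fintype a] [Fintype b] [DecidableEq b] (Ξ : SuperOp a b) : ℝ :=
  sSup (outputTraceNorms Ξ)

/-- The Choi-Jamiołkowski operator `∑ i j, |i⟩⟨j| ⊗ Ξ(|i⟩⟨j|)`. -/
def choi {a b : Type*} [Fintype a] [DecidableEq a] (Ξ : SuperOp a b) :
    Matrix (a × b) (a × b) ℂ :=
  ∑ i, ∑ j, Matrix.single i j (1 : ℂ) ⊗ₖ Ξ (Matrix.single i j 1)

/-- The partial trace over the second tensor factor. -/
def partialTrace₂ {a b : Type*} [Fintype b] (S : Matrix (a × b) (a × b) ℂ) : Matrix a a ℂ :=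
  Matrix.of fun i j => ∑ k, S (i, k) (j, k)

/-- The mixture `∑ x, p(x) B_x`. -/
def mix {a b X : Type*} [Fintype X] (B : X → SuperOp a b) (p : X → ℝ) : SuperOp a b :=
  ∑ x, (p x : ℂ) • B x

/-- The error `½ ‖A - ∑ x, p(x) B_x‖_⋄` of the mixture with weights `p`. -/
def mixError {a b X : Type*} [Fintype a] [Fintype b] [DecidableEq b] [Fintype X]
    (A : SuperOp a b) (B : X → SuperOp a b) (p : X → ℝ) : ℝ :=
  1 / 2 * diamondNorm (A - mix B p)

section SDP

variable {a b X : Type*} [Fintype a] [DecidableEq a] [Fintype b] [DecidableEq b]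

/-- Constraints of the primal problem, in the variables `T`, `ρ`, `t`. -/
structure PrimalFeasible (B : X → SuperOp a b)
    (T : Matrix (a × b) (a × b) ℂ) (ρ : Matrix a a ℂ) (t : ℝ) : Prop where
  nonneg : T.PosSemidef
  le : (ρ ⊗ₖ (1 : Matrix b b ℂ) - T).PosSemidef
  state : IsState ρ
  bound : ∀ x, (choi (B x) * T).trace.re ≤ t

/-- Objective `tr (J(A) T) - t` of the primal problem. -/
def primalObjective (A : SuperOp a b) (T : Matrix (a × b) (a × b) ℂ) (t : ℝ) : ℝ :=
  (choi A * T).trace.re - t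

/-- Constraints of the dual problem, in the variables `r`, `S`, `p`; its objective is `r`. -/
structure DualFeasible [Fintype X] (A : SuperOp a b) (B : X → SuperOp a b)
    (r : ℝ) (S : Matrix (a × b) (a × b) ℂ) (p : X → ℝ) : Prop where
  nonneg : S.PosSemidef
  ge : (S - choi (A - mix B p)).PosSemidef
  partialTrace_le : ((r : ℂ) • (1 : Matrix a a ℂ) - partialTrace₂ S).PosSemidef
  weight_nonneg : ∀ x, 0 ≤ p x
  weight_sum_le : ∑ x, p x ≤ 1

end SDP

end ChannelMixing

end

open ChannelMixing

/-!
Call `(T, ρ)` a *test pair* if `0 ≤ T ≤ ρ ⊗ 1` and `ρ` is a state. The proof rests on three facts.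

* For a Hermiticity-preserving map `Ξ` whose values are traceless, `½ ‖Ξ‖_⋄` is the maximum of
  `tr (J(Ξ) T)` over test pairs (`isGreatest_outputTraceNorms`). A vector `ψ = ∑ i, |i⟩ ⊗ |ψ_i⟩`
  defines an operator `V : |i⟩ ⊗ |c⟩ ↦ |c⟩ ⊗ |ψ_i⟩` (`sliceOp`), for which
  `(Ξ ⊗ id)(|ψ⟩⟨ψ|) = V J(Ξ) Vᴴ` and `Vᴴ V = ρ ⊗ 1`, with `ρ` the Gram matrix of the `ψ_i`. Half
  of the trace norm of the traceless operator `V J Vᴴ` is the maximum of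
  `tr (P V J Vᴴ) = tr (J Vᴴ P V)` over `0 ≤ P ≤ 1`, and `(Vᴴ P V, ρ)` is a test pair. For positive
  definite `ρ` all test pairs are of this form, since `V` is invertible; the others are limits.
* The maximum of `tr (J T)` over test pairs is the least `r` such that some `S ≥ 0` with `S ≥ J`
  satisfies `tr₂ S ≤ r` (`exists_dominating`, `trace_mul_re_le_of_dominating`). For one fixed
  positive definite `ρ = Vᴴ V`, such an `S` with `tr ((ρ ⊗ 1) S) ≤ r` is `V⁻¹ (V J Vᴴ)₊ V⁻ᴴ`. Sion's
  minimax theorem turns this into one `S` that is good for all `ρ` at once, up to a small error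
  caused by mixing `ρ` with the maximally mixed state, and compactness removes the error.
* `(p, (T, ρ)) ↦ tr (J(A - ∑ x, p(x) B_x) T)` has a saddle point on the product of the simplex and
  the set of test pairs, again by Sion's theorem (`exists_saddle`). Its value is the common
  optimum: the test pair in it, with the smallest admissible `t`, is a primal solution, and the
  distribution in it is a dual solution by the second fact.

Weak duality (`primalObjective_le_of_dualFeasible`) shows that nothing does better. The optimal
distributions are then identified by the first two facts, and increasing the weights of a dual
solution keeps it feasible because the operators `J(B_x)` are positive semidefinite.
-/

open ChannelMixing
open scoped Topology

/-! ### Positive semidefinite matrices -/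

theorem Matrix.PosSemidef.exists_eq_conjTranspose_mul_self {n : Type*} [Fintype n]
    {M : Matrix n n ℂ} (hM : M.PosSemidef) : ∃ N : Matrix n n ℂ, M = N.conjTranspose * N := by
  classical
  open scoped MatrixOrder in
  exact CStarAlgebra.nonneg_iff_eq_star_mul_self.mp hM.nonneg

theorem Matrix.PosSemidef.trace_mul_re_nonneg {n : Type*} [Fintype n] {M N : Matrix n n ℂ}
    (hM : M.PosSemidef) (hN : N.PosSemidef) : 0 ≤ (M * N).trace.re := by
  obtain ⟨R, rfl⟩ := hM.exists_eq_conjTranspose_mul_self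
  rw [Matrix.mul_assoc, Matrix.trace_mul_comm]
  exact (Complex.nonneg_iff.mp (hN.mul_mul_conjTranspose_same R).trace_nonneg).1

theorem Matrix.PosSemidef.convexComb {n : Type*} {M N : Matrix n n ℂ} (hM : M.PosSemidef)
    (hN : N.PosSemidef) {s t : ℝ} (hs : 0 ≤ s) (ht : 0 ≤ t) : (s • M + t • N).PosSemidef :=
  (hM.smul hs).add (hN.smul ht)

theorem Matrix.PosSemidef.norm_apply_le_trace {n : Type*} [Fintype n] {M : Matrix n n ℂ}
    (hM : M.PosSemidef) (i j : n) : ‖M i j‖ ≤ M.trace.re := by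
  obtain ⟨N, rfl⟩ := hM.exists_eq_conjTranspose_mul_self
  have hd (i : n) : ((N.conjTranspose * N) i i).re = ∑ k, ‖N k i‖ ^ 2 := by
    simp [Matrix.mul_apply, ← Complex.normSq_eq_conj_mul_self, Complex.normSq_eq_norm_sq,
      -Complex.ofReal_pow]
  have hle (i : n) : ∑ k, ‖N k i‖ ^ 2 ≤ (N.conjTranspose * N).trace.re := by
    rw [Matrix.trace, Complex.re_sum]
    simp only [Matrix.diag_apply, hd]
    exact Finset.single_le_sum (f := fun i => ∑ k, ‖N k i‖ ^ 2)
      (fun i _ => Finset.sum_nonneg fun k _ => by positivity) (Finset.mem_univ i)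
  have h : ‖(N.conjTranspose * N) i j‖ ≤ ∑ k, (‖N k i‖ ^ 2 + ‖N k j‖ ^ 2) / 2 := by
    rw [Matrix.mul_apply]
    refine (norm_sum_le _ _).trans (Finset.sum_le_sum fun k _ => ?_)
    rw [norm_mul, Matrix.conjTranspose_apply, norm_star]
    nlinarith [sq_nonneg (‖N k i‖ - ‖N k j‖)]
  rw [← Finset.sum_div, Finset.sum_add_distrib] at h
  linarith [hle i, hle j]

theorem Matrix.isClosed_setOf_posSemidef (n : Type*) [Fintype n] :
    IsClosed {M : Matrix n n ℂ | M.PosSemidef} := by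
  simp only [Matrix.posSemidef_iff_dotProduct_mulVec, Set.ofPred_and, Set.ofPred_forall]
  refine IsClosed.inter (isClosed_eq (by fun_prop) continuous_id)
    (isClosed_iInter fun x => isClosed_le continuous_const ?_)
  fun_prop

theorem Matrix.isCompact_of_isClosed_of_norm_apply_le {m n : Type*} {s : Set (Matrix m n ℂ)}
    (hs : IsClosed s) (C : ℝ) (h : ∀ M ∈ s, ∀ i j, ‖M i j‖ ≤ C) : IsCompact s := by
  have hc : IsCompact (Set.univ.pi fun _ : m => Set.univ.pi fun _ : n =>
      Metric.closedBall (0 : ℂ) C) :=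
    isCompact_univ_pi fun _ => isCompact_univ_pi fun _ => isCompact_closedBall _ _
  exact hc.of_isClosed_subset hs fun M hM i _ j _ => by simpa using h M hM i j

/-- `N` is the positive part of `M`, and `P` is the spectral projection of `M` onto the nonnegative
eigenvalues. -/
theorem Matrix.IsHermitian.exists_positive_part {n : Type*} [Fintype n] [DecidableEq n]
    {M : Matrix n n ℂ} (hM : M.IsHermitian) :
    ∃ P N : Matrix n n ℂ, P.PosSemidef ∧ (1 - P).PosSemidef ∧ N.PosSemidef ∧
      (N - M).PosSemidef ∧ P * M = N ∧
      traceNorm M = 2 * N.trace.re - M.trace.re := by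
  open scoped MatrixOrder in
  have hsa : IsSelfAdjoint M := hM
  have hc (f : ℝ → ℝ) : ContinuousOn f (spectrum ℝ M) := M.finite_real_spectrum.continuousOn f
  set P := cfc (fun x : ℝ => if 0 ≤ x then (1 : ℝ) else 0) M with hP
  set N := cfc (fun x : ℝ => max x 0) M with hN
  have hPM : P * M = N := by
    conv_lhs => rw [← cfc_id' ℝ M, hP, ← cfc_mul _ _ M (hc _) (hc _)]
    refine cfc_congr fun x _ => ?_
    by_cases hx : 0 ≤ x <;> simp [hx, le_of_not_ge]
  have hN0 : 0 ≤ N := cfc_nonneg fun x _ => le_max_right _ _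
  have hNM : M ≤ N := by
    conv_lhs => rw [← cfc_id' ℝ M]
    exact cfc_mono (fun x _ => le_max_left _ _) (hc _) (hc _)
  have habs : CFC.sqrt (M * M.conjTranspose) = N + (N - M) := by
    have h0 : 0 ≤ N + (N - M) := add_nonneg hN0 (sub_nonneg.mpr hNM)
    have h1 : N + (N - M) = cfc (fun x : ℝ => |x|) M := by
      have h2 : N - M = cfc (fun x : ℝ => max x 0 - x) M := by
        rw [cfc_sub _ _ M (hc _) (hc _), cfc_id' ℝ M]
      rw [h2, hN, ← cfc_add M _ _ (hc _) (hc _)]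
      refine cfc_congr fun x _ => ?_
      rcases le_total 0 x with hx | hx
      · simp [hx, abs_of_nonneg]
      · simp [hx, abs_of_nonpos]
    have h3 : M * M.conjTranspose = (N + (N - M)) * (N + (N - M)) := by
      have h4 : M * M = cfc (fun x : ℝ => x * x) M := by
        rw [cfc_mul _ _ M (hc _) (hc _), cfc_id' ℝ M]
      rw [hM.eq, h1, ← cfc_mul _ _ M (hc _) (hc _), h4]
      exact cfc_congr fun x _ => (abs_mul_abs_self x).symm
    rw [h3, CFC.sqrt_mul_self _ h0]
  refine ⟨P, N, ?_, ?_, Matrix.nonneg_iff_posSemidef.mp hN0, Matrix.le_iff.mp hNM, hPM, ?_⟩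
  · exact Matrix.nonneg_iff_posSemidef.mp (cfc_nonneg fun x _ => by positivity)
  · refine Matrix.le_iff.mp (cfc_le_one _ _ fun x _ => by split_ifs <;> norm_num)
  · rw [traceNorm, habs]
    simp
    ring

/-- An effect `0 ≤ P ≤ 1` detects at most the positive part of `M`; the right-hand side is twice the
trace of the latter. -/
theorem ChannelMixing.two_mul_trace_mul_le_traceNorm {n : Type*} [Fintype n] [DecidableEq n]
    {M P : Matrix n n ℂ} (hM : M.IsHermitian) (hP : P.PosSemidef) (hP1 : (1 - P).PosSemidef) :
    2 * (P * M).trace.re ≤ traceNorm M + M.trace.re := by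
  obtain ⟨-, N, -, -, hN, hNM, -, h⟩ := hM.exists_positive_part
  have h1 := hP.trace_mul_re_nonneg hNM
  have h2 := hP1.trace_mul_re_nonneg hN
  simp only [mul_sub, sub_mul, one_mul, Matrix.trace_sub, Complex.sub_re] at h1 h2
  linarith

/-- A Hermitian matrix with nonnegative expectation in every state is positive semidefinite. -/
theorem ChannelMixing.posSemidef_of_forall_isState {n : Type*} [Fintype n]
    {M : Matrix n n ℂ} (hM : M.IsHermitian)
    (h : ∀ ρ, IsState ρ → 0 ≤ (ρ * M).trace.re) : M.PosSemidef := by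
  refine .of_dotProduct_mulVec_nonneg hM fun x => ?_
  rw [Complex.nonneg_iff]
  have him : (star x ⬝ᵥ M.mulVec x).im = 0 := hM.im_star_dotProduct_mulVec_self x
  refine ⟨?_, him.symm⟩
  by_cases hx : x = 0
  · simp [hx]
  have hpos : 0 < star x ⬝ᵥ x := Matrix.dotProduct_star_self_pos_iff.mpr hx
  obtain ⟨c, hc0, hc⟩ : ∃ c : ℝ, 0 < c ∧ star x ⬝ᵥ x = c := by
    refine ⟨(star x ⬝ᵥ x).re, (Complex.pos_iff.mp hpos).1, ?_⟩
    exact Complex.ext rfl (Complex.pos_iff.mp hpos).2.symm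
  have hs : IsState (((c⁻¹ : ℝ) : ℂ) • Matrix.vecMulVec x (star x)) := by
    constructor
    · exact (Matrix.posSemidef_vecMulVec_self_star x).smul (by simpa using hc0.le)
    · rw [Matrix.trace_smul, Matrix.trace_vecMulVec, dotProduct_comm, hc, smul_eq_mul]
      rw [← Complex.ofReal_mul, inv_mul_cancel₀ hc0.ne', Complex.ofReal_one]
  have := h _ hs
  rw [Matrix.smul_mul, Matrix.trace_smul, Matrix.vecMulVec_mul, Matrix.trace_vecMulVec,
    smul_eq_mul, Complex.re_ofReal_mul, dotProduct_comm, ← Matrix.dotProduct_mulVec] at this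
  exact nonneg_of_mul_nonneg_right this (inv_pos.mpr hc0)

namespace ChannelMixing

/-! ### The Choi operator and slices of bipartite vectors -/

theorem choi_apply {a b : Type*} [Fintype a] [DecidableEq a] (Ξ : SuperOp a b)
    (u v : a × b) : choi Ξ u v = Ξ (Matrix.single u.1 v.1 1) u.2 v.2 := by
  simp only [choi, Matrix.sum_apply, Matrix.kroneckerMap_apply, Matrix.single_apply]
  rw [Finset.sum_eq_single u.1, Finset.sum_eq_single v.1] <;> simp +contextual

theorem choi_sub {a b : Type*} [Fintype a] [DecidableEq a] (Ξ Θ : SuperOp a b) :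
    choi (Ξ - Θ) = choi Ξ - choi Θ := by
  ext u v
  simp [choi_apply]

theorem choi_mix {a b X : Type*} [Fintype a] [DecidableEq a] [Fintype X] (B : X → SuperOp a b)
    (p : X → ℝ) : choi (mix B p) = ∑ x, (p x : ℂ) • choi (B x) := by
  ext u v
  simp [choi_apply, mix, Matrix.sum_apply]

/-- For `ψ = ∑ i, |i⟩ ⊗ |ψ_i⟩`, the operator `|i⟩ ⊗ |c⟩ ↦ |c⟩ ⊗ |ψ_i⟩`. The factors are swapped so
that the codomain is that of `Ξ ⊗ id`. -/
def sliceOp {a e : Type*} (b : Type*) [DecidableEq b] (ψ : a × e → ℂ) : Matrix (b × e) (a × b) ℂ :=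
  Matrix.of fun u v => if u.1 = v.2 then ψ (v.1, u.2) else 0

/-- The Gram matrix `⟨ψ_i, ψ_j⟩` of the slices of `ψ = ∑ i, |i⟩ ⊗ |ψ_i⟩`; it is the transpose of
the reduced operator of `|ψ⟩⟨ψ|` on the first factor. -/
def sliceGram {a e : Type*} [Fintype e] (ψ : a × e → ℂ) : Matrix a a ℂ :=
  Matrix.of fun i j => ∑ u, star (ψ (i, u)) * ψ (j, u)

theorem sliceOp_conjTranspose_mul_self {a b e : Type*} [Fintype b]
    [DecidableEq b] [Fintype e] (ψ : a × e → ℂ) :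
    (sliceOp b ψ).conjTranspose * sliceOp b ψ = sliceGram ψ ⊗ₖ (1 : Matrix b b ℂ) := by
  ext u v
  simp only [Matrix.mul_apply, Matrix.conjTranspose_apply, sliceOp, Matrix.of_apply,
    Matrix.kroneckerMap_apply, sliceGram, Fintype.sum_prod_type, Matrix.one_apply]
  rw [Finset.sum_eq_single u.2]
  · by_cases h : u.2 = v.2 <;> simp [h]
  · intro c _ hc
    simp [hc]
  · simp

theorem sliceGram_eq_mul {a e : Type*} [Fintype e] (ψ : a × e → ℂ) :
    sliceGram ψ = (Matrix.of fun u i => ψ (i, u) : Matrix e a ℂ).conjTranspose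
      * Matrix.of fun u i => ψ (i, u) := by
  ext i j
  simp [sliceGram, Matrix.mul_apply]

theorem trace_sliceGram {a e : Type*} [Fintype a] [Fintype e] (ψ : a × e → ℂ) :
    (sliceGram ψ).trace = star ψ ⬝ᵥ ψ := by
  simp [sliceGram, Matrix.trace, dotProduct, Fintype.sum_prod_type]

theorem ampl_vecMulVec {a b e : Type*} [Fintype a] [DecidableEq a] [Fintype b]
    [DecidableEq b] (Ξ : SuperOp a b) (ψ : a × e → ℂ) :
    ampl Ξ e (Matrix.vecMulVec ψ (star ψ))
      = sliceOp b ψ * choi Ξ * (sliceOp b ψ).conjTranspose := by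
  ext u v
  have h : (Matrix.of fun i j => Matrix.vecMulVec ψ (star ψ) (i, u.2) (j, v.2))
      = ∑ i, ∑ j, (ψ (i, u.2) * star (ψ (j, v.2))) • Matrix.single i j (1 : ℂ) := by
    conv_lhs => rw [Matrix.matrix_eq_sum_single (Matrix.of _)]
    simp [Matrix.vecMulVec_apply, Matrix.smul_single]
  change Ξ (Matrix.of fun i j => Matrix.vecMulVec ψ (star ψ) (i, u.2) (j, v.2)) u.1 v.1 = _
  rw [h]
  simp only [map_sum, map_smul, Matrix.sum_apply, Matrix.smul_apply, smul_eq_mul,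
    Matrix.mul_apply, choi_apply, sliceOp, Matrix.of_apply, Matrix.conjTranspose_apply,
    Fintype.sum_prod_type, Finset.sum_mul]
  rw [Finset.sum_comm]
  refine Finset.sum_congr rfl fun j _ => ?_
  rw [Finset.sum_eq_single v.1]
  · refine Finset.sum_congr rfl fun i _ => ?_
    rw [Finset.sum_eq_single u.1]
    · simp; ring
    · intro c _ hc; simp [hc.symm]
    · simp
  · intro c _ hc; simp [hc.symm]
  · simp

theorem trace_ampl {a b e : Type*} [Fintype b] [Fintype e] {Ξ : SuperOp a b}
    (hΞ : ∀ M, (Ξ M).trace = 0) (M : Matrix (a × e) (a × e) ℂ) :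
    (ampl Ξ e M).trace = 0 := by
  rw [Matrix.trace, Fintype.sum_prod_type, Finset.sum_comm]
  exact Finset.sum_eq_zero fun u _ => hΞ (Matrix.of fun i j => M (i, u) (j, u))

/-- The Choi operator is, up to a permutation of the basis, the image under `Ξ ⊗ id` of an
unnormalized maximally entangled state. -/
theorem IsCPTP.choi_posSemidef {a b : Type*} [Fintype a] [DecidableEq a] [Fintype b]
    [DecidableEq b] {Ξ : SuperOp a b} (hΞ : IsCPTP Ξ) :
    (choi Ξ).PosSemidef := by
  let f := Fintype.equivFin a
  let ω : a × Fin (Fintype.card a) → ℂ := fun i => if f i.1 = i.2 then 1 else 0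
  have h := hΞ.completelyPositive _ _ (Matrix.posSemidef_vecMulVec_self_star ω)
  have h2 : (sliceGram ω : Matrix a a ℂ) = 1 := by
    ext i j
    simp [sliceGram, ω, Matrix.one_apply, eq_comm]
  have h3 : (sliceOp b ω).conjTranspose * sliceOp b ω = 1 := by
    rw [sliceOp_conjTranspose_mul_self, h2, Matrix.one_kronecker_one]
  have h4 := h.conjTranspose_mul_mul_same (sliceOp b ω)
  rw [ampl_vecMulVec] at h4
  convert h4 using 1
  calc choi Ξ = 1 * choi Ξ * 1 := by simp
    _ = _ := by rw [← h3]; simp only [Matrix.mul_assoc]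

theorem trace_mul_partialTrace₂ {a b : Type*} [Fintype a] [Fintype b] [DecidableEq b]
    (ρ : Matrix a a ℂ) (S : Matrix (a × b) (a × b) ℂ) :
    (ρ * partialTrace₂ S).trace = (ρ ⊗ₖ (1 : Matrix b b ℂ) * S).trace := by
  simp only [Matrix.trace, Matrix.diag_apply, Matrix.mul_apply, partialTrace₂, Matrix.of_apply,
    Fintype.sum_prod_type, Matrix.kroneckerMap_apply, Matrix.one_apply, Finset.mul_sum]
  refine Finset.sum_congr rfl fun i _ => ?_
  rw [Finset.sum_comm]
  refine Finset.sum_congr rfl fun c _ => Finset.sum_congr rfl fun j _ => ?_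
  rw [Finset.sum_eq_single c] <;> simp +contextual [eq_comm]

end ChannelMixing

/-! ### Saddle points -/

/-- Sion's minimax theorem for separately continuous functions that are affine in each variable. -/
theorem Sion.exists_isSaddlePointOn_of_biaffine {E F : Type*} [TopologicalSpace E] [AddCommGroup E]
    [Module ℝ E] [IsTopologicalAddGroup E] [ContinuousSMul ℝ E] [TopologicalSpace F]
    [AddCommGroup F] [Module ℝ F] [IsTopologicalAddGroup F] [ContinuousSMul ℝ F]
    {X : Set E} {Y : Set F} {f : E → F → ℝ} (hX : X.Nonempty) (cX : Convex ℝ X)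
    (kX : IsCompact X) (hY : Y.Nonempty) (cY : Convex ℝ Y) (kY : IsCompact Y)
    (hfX : ∀ y, Continuous fun x => f x y) (hfY : ∀ x, Continuous (f x))
    (afX : ∀ y x x' (s t : ℝ), s + t = 1 → f (s • x + t • x') y = s * f x y + t * f x' y)
    (afY : ∀ x y y' (s t : ℝ), s + t = 1 → f x (s • y + t • y') = s * f x y + t * f x y') :
    ∃ x ∈ X, ∃ y ∈ Y, ∀ x' ∈ X, ∀ y' ∈ Y, f x y' ≤ f x' y := by
  refine Sion.exists_isSaddlePointOn hX cX kX
    (fun y _ => (hfX y).lowerSemicontinuous.lowerSemicontinuousOn X) (fun y _ => ?_) cY hY kY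
    (fun x _ => (hfY x).upperSemicontinuous.upperSemicontinuousOn Y) fun x _ => ?_
  · exact ConvexOn.quasiconvexOn ⟨cX, fun x _ x' _ s t _ _ h => (afX y x x' s t h).le⟩
  · exact ConcaveOn.quasiconcaveOn ⟨cY, fun y _ y' _ s t _ _ h => (afY x y y' s t h).ge⟩

namespace ChannelMixing

/-! ### States and test pairs -/

theorem isState_convex (a : Type*) [Fintype a] : Convex ℝ {ρ : Matrix a a ℂ | IsState ρ} := by
  intro ρ hρ σ hσ s t hs ht hst
  refine ⟨hρ.1.convexComb hσ.1 hs ht, ?_⟩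
  rw [Matrix.trace_add, Matrix.trace_smul, Matrix.trace_smul, hρ.2, hσ.2, ← add_smul, hst, one_smul]

theorem isState_isCompact (a : Type*) [Fintype a] :
    IsCompact {ρ : Matrix a a ℂ | IsState ρ} := by
  refine Matrix.isCompact_of_isClosed_of_norm_apply_le ?_ 1 fun ρ hρ i j => ?_
  · exact (Matrix.isClosed_setOf_posSemidef a).inter
      (isClosed_eq (continuous_id.matrix_trace) continuous_const)
  · simpa [hρ.2] using hρ.1.norm_apply_le_trace i j

/-- The maximally mixed state. -/
noncomputable def mixedState (a : Type*) [Fintype a] [DecidableEq a] : Matrix a a ℂ :=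
  ((Fintype.card a : ℝ)⁻¹) • 1

theorem isState_mixedState (a : Type*) [Fintype a] [DecidableEq a] [Nonempty a] :
    IsState (mixedState a) := by
  refine ⟨Matrix.PosSemidef.one.smul (by positivity), ?_⟩
  simp [mixedState, Matrix.trace_smul]

theorem mixedState_posDef (a : Type*) [Fintype a] [DecidableEq a] [Nonempty a] :
    (mixedState a).PosDef :=
  Matrix.PosDef.one.smul (inv_pos.mpr (by exact_mod_cast Fintype.card_pos))

/-- The test pairs: `(T, ρ)` with `0 ≤ T ≤ ρ ⊗ 1` and `ρ` a state. -/
def testRegion (a b : Type*) [Fintype a] [Fintype b] [DecidableEq b] :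
    Set (Matrix (a × b) (a × b) ℂ × Matrix a a ℂ) :=
  {z | z.1.PosSemidef ∧ (z.2 ⊗ₖ (1 : Matrix b b ℂ) - z.1).PosSemidef ∧ IsState z.2}

section
variable {a b : Type*} [Fintype a] [Fintype b] [DecidableEq b]

theorem testRegion_convex : Convex ℝ (testRegion a b) := by
  rintro ⟨T, ρ⟩ ⟨h1, h2, h3⟩ ⟨T', ρ'⟩ ⟨h1', h2', h3'⟩ s t hs ht hst
  refine ⟨h1.convexComb h1' hs ht, ?_, isState_convex a h3 h3' hs ht hst⟩
  convert h2.convexComb h2' hs ht using 1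
  simp [Matrix.add_kronecker, Matrix.smul_kronecker, smul_sub]
  abel

theorem testRegion_isCompact : IsCompact (testRegion a b) := by
  have hT : IsCompact {T : Matrix (a × b) (a × b) ℂ |
      T.PosSemidef ∧ T.trace.re ≤ Fintype.card b} := by
    refine Matrix.isCompact_of_isClosed_of_norm_apply_le ?_ (Fintype.card b) fun T hT i j =>
      (hT.1.norm_apply_le_trace i j).trans hT.2
    exact (Matrix.isClosed_setOf_posSemidef _).inter
      (isClosed_le (Complex.continuous_re.comp continuous_id.matrix_trace) continuous_const)
  refine (hT.prod (isState_isCompact a)).of_isClosed_subset ?_ ?_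
  · refine IsClosed.inter ((Matrix.isClosed_setOf_posSemidef _).preimage continuous_fst)
      (IsClosed.inter ((Matrix.isClosed_setOf_posSemidef _).preimage ?_)
      ((isState_isCompact a).isClosed.preimage continuous_snd))
    refine Continuous.sub ?_ continuous_fst
    refine continuous_matrix fun i j => ?_
    simp only [Matrix.kroneckerMap_apply]
    exact (continuous_snd.matrix_elem _ _).mul continuous_const
  · rintro ⟨T, ρ⟩ ⟨h1, h2, h3⟩
    refine ⟨⟨h1, ?_⟩, h3⟩
    have := (Complex.nonneg_iff.mp h2.trace_nonneg).1
    simp only [Matrix.trace_sub, Matrix.trace_kronecker, h3.2, Matrix.trace_one] at this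
    simpa using this

theorem zero_mem_testRegion [DecidableEq a] [Nonempty a] : (0, mixedState a) ∈ testRegion a b :=
  ⟨.zero, by simpa using (isState_mixedState a).1.kronecker .one, isState_mixedState a⟩

/-- A test pair from a decomposition `∑ k, |ψ_k⟩⟨ψ_k|` of an input state and an effect `P` on the
output. -/
theorem sum_sliceOp_mem_testRegion {e ι : Type*} [Fintype e] [DecidableEq e]
    (s : Finset ι) {ψ : ι → a × e → ℂ} (hψ : ∑ k ∈ s, star (ψ k) ⬝ᵥ ψ k = 1)
    {P : Matrix (b × e) (b × e) ℂ}
    (hP : P.PosSemidef) (hP1 : (1 - P).PosSemidef) :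
    (∑ k ∈ s, (sliceOp b (ψ k)).conjTranspose * P * sliceOp b (ψ k), ∑ k ∈ s, sliceGram (ψ k))
      ∈ testRegion a b := by
  refine ⟨Matrix.posSemidef_sum _ fun k _ => hP.conjTranspose_mul_mul_same _, ?_, ?_, ?_⟩
  · have h : (∑ k ∈ s, sliceGram (ψ k)) ⊗ₖ (1 : Matrix b b ℂ)
        = ∑ k ∈ s, sliceGram (ψ k) ⊗ₖ (1 : Matrix b b ℂ) := by
      ext u v
      simp [Matrix.sum_apply, Matrix.kroneckerMap_apply, Finset.sum_mul]
    rw [h, ← Finset.sum_sub_distrib]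
    refine Matrix.posSemidef_sum _ fun k _ => ?_
    rw [← sliceOp_conjTranspose_mul_self]
    convert hP1.conjTranspose_mul_mul_same (sliceOp b (ψ k)) using 1
    rw [Matrix.mul_sub, Matrix.sub_mul, Matrix.mul_one]
  · exact Matrix.posSemidef_sum _ fun k _ => by
      rw [sliceGram_eq_mul]; exact Matrix.posSemidef_conjTranspose_mul_self _
  · simpa [Matrix.trace_sum, trace_sliceGram] using hψ

/-- Every positive definite `ρ` is the Gram matrix of the slices of a vector whose `sliceOp` is
invertible, with inverse `W`. -/
theorem exists_sliceOp_inverse_of_posDef [DecidableEq a] {ρ : Matrix a a ℂ} (hρ : ρ.PosDef) :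
    ∃ (ψ : a × Fin (Fintype.card a) → ℂ) (W : Matrix (a × b) (b × Fin (Fintype.card a)) ℂ),
      sliceGram ψ = ρ ∧ sliceOp b ψ * W = 1 ∧ W * sliceOp b ψ = 1 := by
  obtain ⟨R, hR⟩ := hρ.posSemidef.exists_eq_conjTranspose_mul_self
  let f := Fintype.equivFin a
  let ψ : a × Fin (Fintype.card a) → ℂ := fun i => R (f.symm i.2) i.1
  have hψ : sliceGram ψ = ρ := by
    ext i j
    rw [hR, Matrix.mul_apply, ← f.symm.sum_comp]
    simp [sliceGram, ψ]
  have hW : (ρ⁻¹ ⊗ₖ (1 : Matrix b b ℂ) * (sliceOp b ψ).conjTranspose) * sliceOp b ψ = 1 := by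
    rw [Matrix.mul_assoc, sliceOp_conjTranspose_mul_self, hψ, ← Matrix.mul_kronecker_mul,
      Matrix.nonsing_inv_mul _ ((Matrix.isUnit_iff_isUnit_det _).mp hρ.isUnit), Matrix.one_mul,
      Matrix.one_kronecker_one]
  refine ⟨ψ, _, hψ, ?_, hW⟩
  exact (Matrix.mul_eq_one_comm_of_equiv
    ((Equiv.prodComm b _).trans (f.symm.prodCongr (Equiv.refl b)))).mpr hW

/-- Linear functionals on the test pairs are maximized by a test pair that comes from a pure state
and an effect: such pairs form a compact set, and those with positive definite `ρ`, all of which are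
among them, are dense in the set of all test pairs. -/
theorem exists_pure_maximizer [DecidableEq a] [Nonempty a] (J : Matrix (a × b) (a × b) ℂ) :
    ∃ (ψ : a × Fin (Fintype.card a) → ℂ)
      (P : Matrix (b × Fin (Fintype.card a)) (b × Fin (Fintype.card a)) ℂ),
      star ψ ⬝ᵥ ψ = 1 ∧ P.PosSemidef ∧ (1 - P).PosSemidef ∧
      ∀ z ∈ testRegion a b, (J * z.1).trace.re
        ≤ (J * ((sliceOp b ψ).conjTranspose * P * sliceOp b ψ)).trace.re := by
  have hc1 : IsCompact {ψ : a × Fin (Fintype.card a) → ℂ | star ψ ⬝ᵥ ψ = 1} := by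
    have hK : IsCompact (Set.univ.pi fun _ : a × Fin (Fintype.card a) =>
      Metric.closedBall (0 : ℂ) 1) := isCompact_univ_pi fun _ => isCompact_closedBall _ _
    refine hK.of_isClosed_subset (isClosed_eq ?_ continuous_const) fun ψ hψ i _ => ?_
    · simp only [dotProduct]
      fun_prop
    · have h : ∑ i, ‖ψ i‖ ^ 2 = 1 := by
        have := congrArg Complex.re hψ
        simpa [dotProduct, ← Complex.normSq_eq_conj_mul_self, Complex.normSq_eq_norm_sq,
          -Complex.ofReal_pow] using this
      have := Finset.single_le_sum (f := fun i => ‖ψ i‖ ^ 2) (fun i _ => by positivity)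
        (Finset.mem_univ i)
      rw [mem_closedBall_zero_iff]
      nlinarith [norm_nonneg (ψ i)]
  have hc2 : IsCompact {P : Matrix (b × Fin (Fintype.card a)) (b × Fin (Fintype.card a)) ℂ |
      P.PosSemidef ∧ (1 - P).PosSemidef} := by
    refine Matrix.isCompact_of_isClosed_of_norm_apply_le
      ((Matrix.isClosed_setOf_posSemidef _).inter
        ((Matrix.isClosed_setOf_posSemidef _).preimage (continuous_const.sub continuous_id)))
      (Fintype.card (b × Fin (Fintype.card a))) fun P hP i j =>
        (hP.1.norm_apply_le_trace i j).trans ?_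
    have := (Complex.nonneg_iff.mp hP.2.trace_nonneg).1
    simpa [Matrix.trace_sub] using this
  obtain ⟨⟨ψ, P⟩, ⟨hψ, hP⟩, hmax⟩ := (hc1.prod hc2).exists_isMaxOn (f := fun z =>
      (J * ((sliceOp b z.1).conjTranspose * z.2 * sliceOp b z.1)).trace.re) (by
    let i : a := Classical.arbitrary a
    exact ⟨(Pi.single (i, Fintype.equivFin a i) 1, 0), by simp, .zero, by simpa using .one⟩) (by
    have hV : Continuous fun z : (a × Fin (Fintype.card a) → ℂ) ×
        Matrix (b × Fin (Fintype.card a)) (b × Fin (Fintype.card a)) ℂ => sliceOp b z.1 := by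
      refine continuous_matrix fun u v => ?_
      simp only [sliceOp, Matrix.of_apply]
      split_ifs <;> fun_prop
    refine (Complex.continuous_re.comp (Continuous.matrix_trace ?_)).continuousOn
    exact continuous_const.matrix_mul
      ((hV.matrix_conjTranspose.matrix_mul continuous_snd).matrix_mul hV))
  refine ⟨ψ, P, hψ, hP.1, hP.2, ?_⟩
  set F := (J * ((sliceOp b ψ).conjTranspose * P * sliceOp b ψ)).trace.re with hF
  have hinv : ∀ z ∈ testRegion a b, z.2.PosDef → (J * z.1).trace.re ≤ F := by
    rintro ⟨T, ρ⟩ ⟨h1, h2, h3⟩ hρ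
    obtain ⟨φ, W, hφ, hVW, hWV⟩ := exists_sliceOp_inverse_of_posDef (b := b) hρ
    have hWV' : (sliceOp b φ).conjTranspose * W.conjTranspose = 1 := by
      rw [← Matrix.conjTranspose_mul, hWV, Matrix.conjTranspose_one]
    have hVW' : W.conjTranspose * (sliceOp b φ).conjTranspose = 1 := by
      rw [← Matrix.conjTranspose_mul, hVW, Matrix.conjTranspose_one]
    have hQ1 : (1 - W.conjTranspose * T * W).PosSemidef := by
      convert h2.conjTranspose_mul_mul_same W using 1
      rw [Matrix.mul_sub, Matrix.sub_mul, ← hφ, ← sliceOp_conjTranspose_mul_self,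
        ← Matrix.mul_assoc, hVW', Matrix.one_mul, hVW]
    have hφ1 : star φ ⬝ᵥ φ = 1 := by rw [← trace_sliceGram, hφ, h3.2]
    have h : (J * ((sliceOp b φ).conjTranspose * (W.conjTranspose * T * W)
        * sliceOp b φ)).trace.re ≤ F :=
      hmax (a := (φ, W.conjTranspose * T * W)) ⟨hφ1, h1.conjTranspose_mul_mul_same W, hQ1⟩
    convert h using 3
    calc J * T = J * (((sliceOp b φ).conjTranspose * W.conjTranspose) * T
          * (W * sliceOp b φ)) := by rw [hWV, hWV', Matrix.one_mul, Matrix.mul_one]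
      _ = _ := by simp only [Matrix.mul_assoc]
  rintro ⟨T, ρ⟩ hz
  -- Mixing with `(0, mixedState a)` makes the second component positive definite.
  have hlim : ∀ ε ∈ Set.Ioo (0 : ℝ) 1, (1 - ε) * (J * T).trace.re ≤ F := by
    intro ε hε
    have h := hinv _ (testRegion_convex hz zero_mem_testRegion (sub_nonneg.mpr hε.2.le) hε.1.le
      (sub_add_cancel 1 ε)) (by
        exact ((mixedState_posDef a).smul hε.1).posSemidef_add
          (hz.2.2.1.smul (sub_nonneg.mpr hε.2.le)))
    simpa [Matrix.trace_smul] using h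
  refine le_of_tendsto (x := 𝓝[>] (0 : ℝ)) (f := fun ε => (1 - ε) * (J * T).trace.re) ?_ ?_
  · have : Continuous fun ε : ℝ => (1 - ε) * (J * T).trace.re := by fun_prop
    simpa using (this.tendsto 0).mono_left nhdsWithin_le_nhds
  · filter_upwards [Ioo_mem_nhdsGT one_pos] with ε hε using hlim ε hε

/-! ### The diamond norm as a maximum over test pairs -/

theorem trace_mul_conjTranspose_mul_mul {m n : Type*} [Fintype m] [Fintype n] (J : Matrix n n ℂ)
    (V : Matrix m n ℂ) (P : Matrix m m ℂ) :
    (J * (V.conjTranspose * P * V)).trace = (P * (V * J * V.conjTranspose)).trace := by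
  rw [← Matrix.mul_assoc, Matrix.trace_mul_comm, ← Matrix.mul_assoc J, ← Matrix.mul_assoc,
    ← Matrix.mul_assoc, Matrix.trace_mul_comm]

/-- The diamond norm of a Hermiticity-preserving map with traceless values is attained, and it is
twice the maximum of `tr (J(Ξ) T)` over the test pairs, which is attained at `z₀`. -/
theorem isGreatest_outputTraceNorms [DecidableEq a] [Nonempty a] {Ξ : SuperOp a b}
    (hJ : (choi Ξ).IsHermitian) (htr : ∀ M, (Ξ M).trace = 0) :
    ∃ z₀ ∈ testRegion a b,
      (∀ z ∈ testRegion a b, (choi Ξ * z.1).trace.re ≤ (choi Ξ * z₀.1).trace.re) ∧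
      IsGreatest (outputTraceNorms Ξ) (2 * (choi Ξ * z₀.1).trace.re) := by
  obtain ⟨ψ, P, hψ, hP, hP1, hmax⟩ := exists_pure_maximizer (b := b) (choi Ξ)
  have hz₀ := sum_sliceOp_mem_testRegion (b := b) {()} (ψ := fun _ => ψ) (by simpa using hψ) hP hP1
  simp only [Finset.sum_singleton] at hz₀
  refine ⟨_, hz₀, hmax, ?_⟩
  set F := (choi Ξ * ((sliceOp b ψ).conjTranspose * P * sliceOp b ψ)).trace.re with hF
  have hub : 2 * F ∈ upperBounds (outputTraceNorms Ξ) := by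
    rintro _ ⟨n, Φ, ⟨⟨hΦ, hΦ1⟩, -⟩, rfl⟩
    -- Split `Φ` into rank-one terms, each of which `ampl_vecMulVec` describes.
    obtain ⟨N, hN⟩ := hΦ.exists_eq_conjTranspose_mul_self
    let φ : a × Fin n → a × Fin n → ℂ := fun k => star (N k)
    have hΦs : Φ = ∑ k, Matrix.vecMulVec (φ k) (star (φ k)) := by
      ext i j
      simp [hN, Matrix.mul_apply, Matrix.sum_apply, Matrix.vecMulVec_apply, φ]
    have hφ : ∑ k, star (φ k) ⬝ᵥ φ k = 1 := by
      rw [← hΦ1, hΦs, Matrix.trace_sum]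
      exact Finset.sum_congr rfl fun k _ => by rw [Matrix.trace_vecMulVec, dotProduct_comm]
    have hM : ampl Ξ (Fin n) Φ
        = ∑ k, sliceOp b (φ k) * choi Ξ * (sliceOp b (φ k)).conjTranspose := by
      rw [hΦs, map_sum]
      exact Finset.sum_congr rfl fun k _ => ampl_vecMulVec Ξ (φ k)
    have hMh : (ampl Ξ (Fin n) Φ).IsHermitian := by
      rw [hM]
      exact isSelfAdjoint_sum _ fun k _ => Matrix.isHermitian_mul_mul_conjTranspose _ hJ
    obtain ⟨Q, N', hQ, hQ1, -, -, hQM, hn⟩ := hMh.exists_positive_part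
    have h := hmax _ (sum_sliceOp_mem_testRegion (b := b) Finset.univ hφ hQ hQ1)
    have h2 : (choi Ξ * ∑ k, (sliceOp b (φ k)).conjTranspose * Q * sliceOp b (φ k)).trace
        = N'.trace := by
      rw [← hQM, hM, Matrix.mul_sum, Matrix.mul_sum, Matrix.trace_sum, Matrix.trace_sum]
      exact Finset.sum_congr rfl fun k _ => trace_mul_conjTranspose_mul_mul _ _ _
    rw [h2] at h
    rw [hn, trace_ampl htr]
    simpa using h
  have hpure : IsPureState (Matrix.vecMulVec ψ (star ψ)) := by
    refine ⟨⟨Matrix.posSemidef_vecMulVec_self_star ψ, ?_⟩, ?_⟩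
    · rw [Matrix.trace_vecMulVec, dotProduct_comm, hψ]
    · rw [Matrix.vecMulVec_mul_vecMulVec, hψ]
      simp [Matrix.trace_vecMulVec, dotProduct_comm ψ, hψ]
  refine ⟨⟨_, _, hpure, le_antisymm ?_ (hub ⟨_, _, hpure, rfl⟩)⟩, hub⟩
  have hM := ampl_vecMulVec Ξ ψ
  have hMh : (ampl Ξ _ (Matrix.vecMulVec ψ (star ψ))).IsHermitian := by
    rw [hM]
    exact Matrix.isHermitian_mul_mul_conjTranspose _ hJ
  have h := two_mul_trace_mul_le_traceNorm hMh hP hP1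
  rwa [trace_ampl htr, Complex.zero_re, add_zero, hM, ← trace_mul_conjTranspose_mul_mul, ← hF,
    ← hM] at h

/-! ### Dual characterization of the maximum over test pairs -/

/-- For one positive definite state `ρ`, an optimal `S` is the positive part of `V J Vᴴ` pulled back
along the inverse `W` of the invertible operator `V` with `Vᴴ V = ρ ⊗ 1`. -/
theorem exists_dominating_of_posDef [DecidableEq a] {J : Matrix (a × b) (a × b) ℂ}
    (hJ : J.IsHermitian) {F : ℝ} (hF : ∀ z ∈ testRegion a b, (J * z.1).trace.re ≤ F)
    {ρ : Matrix a a ℂ} (hρ : ρ.PosDef) (hρ1 : ρ.trace = 1) :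
    ∃ S : Matrix (a × b) (a × b) ℂ, S.PosSemidef ∧ (S - J).PosSemidef ∧
      (ρ ⊗ₖ (1 : Matrix b b ℂ) * S).trace.re ≤ F := by
  obtain ⟨ψ, W, hψ, hVW, hWV⟩ := exists_sliceOp_inverse_of_posDef (b := b) hρ
  have hWV' : (sliceOp b ψ).conjTranspose * W.conjTranspose = 1 := by
    rw [← Matrix.conjTranspose_mul, hWV, Matrix.conjTranspose_one]
  have hVW' : W.conjTranspose * (sliceOp b ψ).conjTranspose = 1 := by
    rw [← Matrix.conjTranspose_mul, hVW, Matrix.conjTranspose_one]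
  have hMh := Matrix.isHermitian_mul_mul_conjTranspose (sliceOp b ψ) hJ
  obtain ⟨P, N, hP, hP1, hN, hNM, hPM, -⟩ := hMh.exists_positive_part
  refine ⟨W * N * W.conjTranspose, hN.mul_mul_conjTranspose_same W, ?_, ?_⟩
  · convert hNM.mul_mul_conjTranspose_same W using 1
    rw [Matrix.mul_sub, Matrix.sub_mul]
    congr 1
    calc J = (W * sliceOp b ψ) * J * ((sliceOp b ψ).conjTranspose * W.conjTranspose) := by
          rw [hWV, hWV', Matrix.one_mul, Matrix.mul_one]
      _ = _ := by simp only [Matrix.mul_assoc]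
  · have h := hF _ (sum_sliceOp_mem_testRegion (b := b) {()} (ψ := fun _ => ψ)
      (by simp [← trace_sliceGram, hψ, hρ1]) hP hP1)
    simp only [Finset.sum_singleton] at h
    convert h using 2
    rw [← hψ, ← sliceOp_conjTranspose_mul_self]
    calc ((sliceOp b ψ).conjTranspose * sliceOp b ψ * (W * N * W.conjTranspose)).trace
        = ((sliceOp b ψ).conjTranspose * (sliceOp b ψ * W) * (N * W.conjTranspose)).trace := by
          simp only [Matrix.mul_assoc]
      _ = (N * (W.conjTranspose * (sliceOp b ψ).conjTranspose)).trace := by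
          rw [hVW, Matrix.mul_one, Matrix.trace_mul_comm, Matrix.mul_assoc]
      _ = (P * (sliceOp b ψ * J * (sliceOp b ψ).conjTranspose)).trace := by
          rw [hVW', Matrix.mul_one, hPM]
      _ = _ := (trace_mul_conjTranspose_mul_mul _ _ _).symm

theorem dominating_isCompact {n : Type*} [Fintype n] (J : Matrix n n ℂ) (C : ℝ) :
    IsCompact {S : Matrix n n ℂ |
      S.PosSemidef ∧ (S - J).PosSemidef ∧ S.trace.re ≤ C} := by
  refine Matrix.isCompact_of_isClosed_of_norm_apply_le ?_ C fun S hS i j =>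
    (hS.1.norm_apply_le_trace i j).trans hS.2.2
  exact (Matrix.isClosed_setOf_posSemidef _).inter
    (((Matrix.isClosed_setOf_posSemidef _).preimage (continuous_id.sub continuous_const)).inter
    (isClosed_le (Complex.continuous_re.comp continuous_id.matrix_trace) continuous_const))

theorem trace_mixedState_kronecker_mul [DecidableEq a] (S : Matrix (a × b) (a × b) ℂ) :
    (mixedState a ⊗ₖ (1 : Matrix b b ℂ) * S).trace.re = (Fintype.card a : ℝ)⁻¹ * S.trace.re := by
  simp [mixedState, Matrix.smul_kronecker, Matrix.trace_smul]

/-- One `S` that works for all states, up to the factor `1 - ε`. Mixing `ρ` with `ε` times the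
maximally mixed state bounds the trace of the `S` belonging to `ρ`, and thus allows the minimax
theorem to be applied to a compact set of operators `S`. -/
theorem exists_dominating_of_lt_one [DecidableEq a] [Nonempty a] {J : Matrix (a × b) (a × b) ℂ}
    (hJ : J.IsHermitian) {F : ℝ} (hF : ∀ z ∈ testRegion a b, (J * z.1).trace.re ≤ F)
    {ε : ℝ} (hε : 0 < ε) (hε1 : ε < 1) :
    ∃ S : Matrix (a × b) (a × b) ℂ, S.PosSemidef ∧ (S - J).PosSemidef ∧
      ∀ ρ, IsState ρ → (1 - ε) * (ρ ⊗ₖ (1 : Matrix b b ℂ) * S).trace.re ≤ F := by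
  set d := (Fintype.card a : ℝ) with hd
  have hd0 : 0 < d := by rw [hd]; exact_mod_cast Fintype.card_pos
  let f : Matrix (a × b) (a × b) ℂ → Matrix a a ℂ → ℝ := fun S ρ =>
    (1 - ε) * (ρ ⊗ₖ (1 : Matrix b b ℂ) * S).trace.re + ε * (d⁻¹ * S.trace.re)
  have hf (S) (ρ : Matrix a a ℂ) : f S ρ
      = (((1 - ε) • ρ + ε • mixedState a) ⊗ₖ (1 : Matrix b b ℂ) * S).trace.re := by
    rw [Matrix.add_kronecker, Matrix.smul_kronecker, Matrix.smul_kronecker, Matrix.add_mul,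
      Matrix.smul_mul, Matrix.smul_mul, Matrix.trace_add, Matrix.trace_smul, Matrix.trace_smul,
      Complex.add_re, Complex.smul_re, Complex.smul_re, trace_mixedState_kronecker_mul]
    rfl
  have hinner : ∀ ρ, IsState ρ → ∃ S : Matrix (a × b) (a × b) ℂ,
      (S.PosSemidef ∧ (S - J).PosSemidef ∧ S.trace.re ≤ d * F / ε) ∧ f S ρ ≤ F := by
    intro ρ hρ
    have h1 := isState_convex a hρ (isState_mixedState a) (sub_nonneg.mpr hε1.le) hε.le
      (sub_add_cancel 1 ε)
    have h2 : ((1 - ε) • ρ + ε • mixedState a).PosDef :=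
      ((mixedState_posDef a).smul hε).posSemidef_add (hρ.1.smul (sub_nonneg.mpr hε1.le))
    obtain ⟨S, hS, hSJ, hSF⟩ := exists_dominating_of_posDef hJ hF h2 h1.2
    rw [← hf] at hSF
    refine ⟨S, ⟨hS, hSJ, ?_⟩, hSF⟩
    have h3 := (hρ.1.kronecker (Matrix.PosSemidef.one (n := b))).trace_mul_re_nonneg hS
    have h4 : ε * (d⁻¹ * S.trace.re) ≤ F := by
      have := mul_nonneg (sub_nonneg.mpr hε1.le) h3
      simp only [f] at hSF
      linarith
    rw [le_div_iff₀ hε]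
    field_simp at h4
    linarith
  obtain ⟨S, hS, ρ, hρ, hsad⟩ := Sion.exists_isSaddlePointOn_of_biaffine (f := f)
    (let ⟨S, hS, _⟩ := hinner _ (isState_mixedState a); ⟨S, hS⟩)
    (by
      rintro S ⟨h1, h2, h3⟩ S' ⟨h1', h2', h3'⟩ s t hs ht hst
      refine ⟨h1.convexComb h1' hs ht, ?_, ?_⟩
      · convert h2.convexComb h2' hs ht using 1
        conv_lhs => rw [← one_smul ℝ J, ← hst]
        module
      · simp only [Matrix.trace_add, Matrix.trace_smul, Complex.add_re, Complex.smul_re,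
          smul_eq_mul]
        calc _ ≤ s * (d * F / ε) + t * (d * F / ε) := by gcongr
          _ = d * F / ε := by rw [← add_mul, hst, one_mul])
    (dominating_isCompact J _) ⟨_, isState_mixedState a⟩ (isState_convex a) (isState_isCompact a)
    (fun ρ => by
      have h1 : Continuous fun S : Matrix (a × b) (a × b) ℂ =>
          (ρ ⊗ₖ (1 : Matrix b b ℂ) * S).trace.re :=
        Complex.continuous_re.comp (continuous_const.matrix_mul continuous_id).matrix_trace
      have h2 : Continuous fun S : Matrix (a × b) (a × b) ℂ => S.trace.re :=
        Complex.continuous_re.comp continuous_id.matrix_trace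
      simp only [f]
      fun_prop)
    (fun S => by
      have h1 : Continuous fun ρ : Matrix a a ℂ => (ρ ⊗ₖ (1 : Matrix b b ℂ) * S).trace.re := by
        simp only [← trace_mul_partialTrace₂]
        exact Complex.continuous_re.comp (continuous_id.matrix_mul continuous_const).matrix_trace
      simp only [f]
      fun_prop)
    (fun ρ S S' s t hst => by
      simp only [f, Matrix.mul_add, Matrix.mul_smul, Matrix.trace_add, Matrix.trace_smul,
        Complex.add_re, Complex.smul_re, smul_eq_mul]
      ring)
    (fun S ρ ρ' s t hst => by
      simp only [f, Matrix.add_kronecker, Matrix.smul_kronecker, Matrix.add_mul, Matrix.smul_mul,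
        Matrix.trace_add, Matrix.trace_smul, Complex.add_re, Complex.smul_re, smul_eq_mul]
      obtain rfl : t = 1 - s := by linarith
      ring)
  refine ⟨S, hS.1, hS.2.1, fun σ hσ => ?_⟩
  obtain ⟨S', hS', hle⟩ := hinner ρ hρ
  have h1 := (hsad S' hS' σ hσ).trans hle
  have h2 := (Complex.nonneg_iff.mp hS.1.trace_nonneg).1
  have h3 : 0 ≤ ε * (d⁻¹ * S.trace.re) := by positivity
  simp only [f] at h1
  linarith

/-- Strong duality for the maximum of `tr (J T)` over the test pairs, with dual attainment. -/
theorem exists_dominating [DecidableEq a] [Nonempty a] {J : Matrix (a × b) (a × b) ℂ}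
    (hJ : J.IsHermitian) {F : ℝ} (hF : ∀ z ∈ testRegion a b, (J * z.1).trace.re ≤ F) :
    ∃ S : Matrix (a × b) (a × b) ℂ, S.PosSemidef ∧ (S - J).PosSemidef ∧
      ((F : ℂ) • (1 : Matrix a a ℂ) - partialTrace₂ S).PosSemidef := by
  have hε (n : ℕ) : 0 < 1 / ((n : ℝ) + 2) ∧ 1 / ((n : ℝ) + 2) ≤ 1 / 2 := by
    refine ⟨by positivity, ?_⟩
    gcongr
    linarith [n.cast_nonneg (α := ℝ)]
  choose S hS hSJ hSF using fun n : ℕ =>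
    exists_dominating_of_lt_one hJ hF (hε n).1 ((hε n).2.trans_lt (by norm_num))
  have hd0 : (0 : ℝ) < Fintype.card a := by exact_mod_cast Fintype.card_pos
  have : FirstCountableTopology (Matrix (a × b) (a × b) ℂ) :=
    inferInstanceAs (FirstCountableTopology (a × b → a × b → ℂ))
  obtain ⟨S₀, ⟨hS₀, hS₀J, -⟩, φ, hφ, hlim⟩ :=
    (dominating_isCompact J (2 * (Fintype.card a * F))).tendsto_subseq (x := S) fun n => by
      refine ⟨hS n, hSJ n, ?_⟩
      have h := hSF n _ (isState_mixedState a)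
      rw [trace_mixedState_kronecker_mul] at h
      have h1 := (Complex.nonneg_iff.mp (hS n).trace_nonneg).1
      have h2 : 1 / 2 * ((Fintype.card a : ℝ)⁻¹ * (S n).trace.re) ≤ F := by
        refine le_trans (mul_le_mul_of_nonneg_right ?_ (by positivity)) h
        linarith [(hε n).2]
      field_simp at h2
      linarith
  refine ⟨S₀, hS₀, hS₀J, posSemidef_of_forall_isState ?_ fun ρ hρ => ?_⟩
  · refine (Matrix.isHermitian_one.smul (by simp [IsSelfAdjoint])).sub ?_
    ext i j
    simp only [partialTrace₂, Matrix.conjTranspose_apply, Matrix.of_apply, star_sum]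
    exact Finset.sum_congr rfl fun k _ => hS₀.1.apply _ _
  · have h1 : (ρ ⊗ₖ (1 : Matrix b b ℂ) * S₀).trace.re ≤ F := by
      have hc : Continuous fun S : Matrix (a × b) (a × b) ℂ =>
          (ρ ⊗ₖ (1 : Matrix b b ℂ) * S).trace.re :=
        Complex.continuous_re.comp (continuous_const.matrix_mul continuous_id).matrix_trace
      have h2 : Filter.Tendsto (fun n : ℕ => 1 - 1 / ((φ n : ℝ) + 2)) Filter.atTop
          (𝓝 (1 - 0)) := by
        refine tendsto_const_nhds.sub ?_
        have h3 : Filter.Tendsto (fun n : ℕ => (φ n : ℝ) + 2) Filter.atTop Filter.atTop :=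
          Filter.tendsto_atTop_add_const_right _ _
            (tendsto_natCast_atTop_atTop.comp hφ.tendsto_atTop)
        simp only [one_div]
        exact h3.inv_tendsto_atTop
      have h4 := h2.mul ((hc.tendsto S₀).comp hlim)
      rw [sub_zero, one_mul] at h4
      exact le_of_tendsto' h4 fun n => hSF (φ n) ρ hρ
    rw [Matrix.mul_sub, Matrix.trace_sub, trace_mul_partialTrace₂, Matrix.mul_smul,
      Matrix.trace_smul, Matrix.mul_one, hρ.2]
    simpa using h1

end

/-! ### Mixtures and the semidefinite programs -/

theorem IsCPTP.trace_sub_mix_eq_zero {a b X : Type*} [Fintype a] [Fintype b] [Fintype X]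
    {A : SuperOp a b} {B : X → SuperOp a b} (hA : IsCPTP A)
    (hB : ∀ x, IsCPTP (B x)) {p : X → ℝ} (hp : ∑ x, p x = 1) (M : Matrix a a ℂ) :
    ((A - mix B p) M).trace = 0 := by
  simp only [mix, LinearMap.sub_apply, LinearMap.sum_apply, LinearMap.smul_apply,
    Matrix.trace_sub, Matrix.trace_sum, Matrix.trace_smul, hA.tracePreserving,
    (hB _).tracePreserving, smul_eq_mul]
  rw [← Finset.sum_mul, ← Complex.ofReal_sum, hp]
  simp

section

variable {a b X : Type*} [Fintype a] [DecidableEq a] [Fintype b] [DecidableEq b] [Fintype X]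

theorem IsCPTP.choi_sub_mix_isHermitian {A : SuperOp a b} {B : X → SuperOp a b} (hA : IsCPTP A)
    (hB : ∀ x, IsCPTP (B x)) (p : X → ℝ) : (choi (A - mix B p)).IsHermitian := by
  rw [choi_sub, choi_mix]
  refine hA.choi_posSemidef.1.sub (isSelfAdjoint_sum _ fun x _ => ?_)
  exact (hB x).choi_posSemidef.1.smul (by simp [IsSelfAdjoint])

theorem trace_choi_sub_mix_mul (A : SuperOp a b) (B : X → SuperOp a b) (p : X → ℝ)
    (T : Matrix (a × b) (a × b) ℂ) : (choi (A - mix B p) * T).trace.re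
      = (choi A * T).trace.re - ∑ x, p x * (choi (B x) * T).trace.re := by
  simp [choi_sub, choi_mix, sub_mul, Finset.sum_mul, Matrix.trace_sub, Matrix.trace_sum]

/-- Weak duality for the maximum of `tr (J T)` over the test pairs. -/
theorem trace_mul_re_le_of_dominating {J S T : Matrix (a × b) (a × b) ℂ} {ρ : Matrix a a ℂ}
    {r : ℝ} (hz : (T, ρ) ∈ testRegion a b) (hS : S.PosSemidef) (hSJ : (S - J).PosSemidef)
    (hr : ((r : ℂ) • (1 : Matrix a a ℂ) - partialTrace₂ S).PosSemidef) :
    (J * T).trace.re ≤ r := by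
  have h1 := hSJ.trace_mul_re_nonneg hz.1
  have h2 := hz.2.1.trace_mul_re_nonneg hS
  have h3 := hz.2.2.1.trace_mul_re_nonneg hr
  rw [Matrix.trace_mul_comm] at h2
  simp only [Matrix.mul_sub, Matrix.sub_mul, Matrix.trace_sub, Complex.sub_re, Matrix.mul_smul,
    Matrix.mul_one, Matrix.trace_smul, hz.2.2.2, trace_mul_partialTrace₂,
    Matrix.trace_mul_comm S] at h1 h2 h3
  simp only [smul_eq_mul, mul_one, Complex.ofReal_re] at h3
  rw [Matrix.trace_mul_comm T] at h1 h2
  linarith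

/-- Weak duality for the pair of semidefinite programs. -/
theorem primalObjective_le_of_dualFeasible [Nonempty X] {A : SuperOp a b} {B : X → SuperOp a b}
    (hB : ∀ x, IsCPTP (B x)) {T : Matrix (a × b) (a × b) ℂ} {ρ : Matrix a a ℂ} {t r : ℝ}
    {S : Matrix (a × b) (a × b) ℂ} {p : X → ℝ} (hP : PrimalFeasible B T ρ t)
    (hD : DualFeasible A B r S p) : primalObjective A T t ≤ r := by
  have h := trace_mul_re_le_of_dominating ⟨hP.nonneg, hP.le, hP.state⟩ hD.nonneg hD.ge
    hD.partialTrace_le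
  rw [trace_choi_sub_mix_mul] at h
  -- This is what makes `∑ x, p x ≤ 1` sufficient: `t ∑ x, p x ≤ t`.
  have ht : 0 ≤ t := ((hB (Classical.arbitrary X)).choi_posSemidef.trace_mul_re_nonneg
    hP.nonneg).trans (hP.bound _)
  have h1 : ∑ x, p x * (choi (B x) * T).trace.re ≤ ∑ x, p x * t :=
    Finset.sum_le_sum fun x _ => mul_le_mul_of_nonneg_left (hP.bound x) (hD.weight_nonneg x)
  rw [← Finset.sum_mul] at h1
  have h2 := mul_le_of_le_one_left ht hD.weight_sum_le
  unfold primalObjective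
  linarith

/-- For a distribution `p`, the dual problem with fixed weights `p` has the optimum
`mixError A B p`. -/
theorem exists_dualFeasible_iff_mixError_le [Nonempty a] {A : SuperOp a b} {B : X → SuperOp a b}
    (hA : IsCPTP A) (hB : ∀ x, IsCPTP (B x)) {p : X → ℝ} (hp : p ∈ stdSimplex ℝ X) (r : ℝ) :
    (∃ S, DualFeasible A B r S p) ↔ mixError A B p ≤ r := by
  obtain ⟨⟨T, ρ⟩, hz₀, hmax, hg⟩ := isGreatest_outputTraceNorms
    (hA.choi_sub_mix_isHermitian hB p) (hA.trace_sub_mix_eq_zero hB hp.2)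
  have he : mixError A B p = (choi (A - mix B p) * T).trace.re := by
    rw [mixError, diamondNorm, hg.csSup_eq]
    ring
  constructor
  · rintro ⟨S, hS⟩
    rw [he]
    exact trace_mul_re_le_of_dominating hz₀ hS.nonneg hS.ge hS.partialTrace_le
  · intro hr
    obtain ⟨S, h1, h2, h3⟩ := exists_dominating (hA.choi_sub_mix_isHermitian hB p)
      fun z hz => (hmax z hz).trans (he ▸ hr)
    exact ⟨S, h1, h2, h3, hp.1, hp.2.le⟩

/-- Increasing the weights decreases `J(A - ∑ x, p(x) B_x)`, so `S` remains admissible. -/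
theorem DualFeasible.mono {A : SuperOp a b} {B : X → SuperOp a b} (hB : ∀ x, IsCPTP (B x))
    {r : ℝ} {S : Matrix (a × b) (a × b) ℂ} {p q : X → ℝ} (h : DualFeasible A B r S p)
    (hq : q ∈ stdSimplex ℝ X) (hpq : ∀ x, p x ≤ q x) : DualFeasible A B r S q := by
  refine ⟨h.nonneg, ?_, h.partialTrace_le, hq.1, hq.2.le⟩
  have h1 : (∑ x, ((q x - p x : ℝ) : ℂ) • choi (B x)).PosSemidef :=
    Matrix.posSemidef_sum _ fun x _ => (hB x).choi_posSemidef.smul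
      (by exact_mod_cast sub_nonneg.mpr (hpq x))
  convert h.ge.add h1 using 1
  simp only [choi_sub, choi_mix, Complex.ofReal_sub, sub_smul, Finset.sum_sub_distrib]
  abel

/-- The error of a distribution against a test pair has a saddle point. -/
theorem exists_saddle [Nonempty a] [Nonempty X] (A : SuperOp a b) (B : X → SuperOp a b) :
    ∃ p ∈ stdSimplex ℝ X, ∃ z ∈ testRegion a b, ∀ q ∈ stdSimplex ℝ X, ∀ w ∈ testRegion a b,
      (choi (A - mix B p) * w.1).trace.re ≤ (choi (A - mix B q) * z.1).trace.re := by
  have hc (J : Matrix (a × b) (a × b) ℂ) :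
      Continuous fun z : Matrix (a × b) (a × b) ℂ × Matrix a a ℂ => (J * z.1).trace.re :=
    Complex.continuous_re.comp (continuous_const.matrix_mul continuous_fst).matrix_trace
  classical
  refine Sion.exists_isSaddlePointOn_of_biaffine
    (f := fun (p : X → ℝ) (z : Matrix (a × b) (a × b) ℂ × Matrix a a ℂ) =>
      (choi (A - mix B p) * z.1).trace.re)
    ⟨_, single_mem_stdSimplex ℝ (Classical.arbitrary X)⟩ (convex_stdSimplex ℝ X)
    (isCompact_stdSimplex ℝ X) ⟨_, zero_mem_testRegion⟩ testRegion_convex testRegion_isCompact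
    (fun z => ?_) (fun p => hc _) (fun z p q s t hst => ?_) (fun p z w s t _ => ?_)
  · simp only [trace_choi_sub_mix_mul]
    fun_prop
  · simp only [trace_choi_sub_mix_mul, Pi.add_apply, Pi.smul_apply, smul_eq_mul, add_mul,
      mul_assoc, Finset.sum_add_distrib, ← Finset.mul_sum]
    obtain rfl : t = 1 - s := by linarith
    ring
  · simp [Matrix.mul_add, Matrix.trace_add, Matrix.trace_smul]

end
end ChannelMixing

theorem proposition1 {d₁ d₂ X : Type*} [Fintype d₁] [DecidableEq d₁] [Nonempty d₁]
    [Fintype d₂] [DecidableEq d₂] [Fintype X] [Nonempty X]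
    (A : SuperOp d₁ d₂) (B : X → SuperOp d₁ d₂)
    (hA : IsCPTP A) (hB : ∀ x, IsCPTP (B x)) :
    -- the maximum that defines the diamond norm is attained
    (∀ p ∈ stdSimplex ℝ X,
      IsGreatest (outputTraceNorms (A - mix B p)) (diamondNorm (A - mix B p))) ∧
    ∃ v : ℝ,
      -- `v` is the minimum mixing error
      IsLeast (mixError A B '' stdSimplex ℝ X) v ∧
      -- `v` is the optimum of the primal problem and that of the dual problem
      IsGreatest {s | ∃ T ρ t, PrimalFeasible B T ρ t ∧ s = primalObjective A T t} v ∧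
      IsLeast {r | ∃ S p, DualFeasible A B r S p} v ∧
      -- the optimal distributions are the normalized weights of optimal dual solutions
      (∀ p ∈ stdSimplex ℝ X, mixError A B p = v ↔ ∃ S, DualFeasible A B v S p) ∧
      -- sub-normalized weights of an optimal dual solution yield optimal distributions
      (∀ S p, DualFeasible A B v S p →
        ∀ q ∈ stdSimplex ℝ X, (∀ x, p x ≤ q x) → mixError A B q = v) := by
  classical
  refine ⟨fun p hp => ?_, ?_⟩
  · obtain ⟨z₀, -, -, hg⟩ := isGreatest_outputTraceNorms
      (hA.choi_sub_mix_isHermitian hB p) (hA.trace_sub_mix_eq_zero hB hp.2)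
    rwa [diamondNorm, hg.csSup_eq]
  obtain ⟨p, hp, ⟨T, ρ⟩, hz, hsad⟩ := exists_saddle A B
  set v := (choi (A - mix B p) * T).trace.re with hv
  -- Comparing `p` with the point masses shows that `t = tr (J(A) T) - v` is admissible.
  have hprimal : PrimalFeasible B T ρ ((choi A * T).trace.re - v) := by
    refine ⟨hz.1, hz.2.1, hz.2.2, fun x => ?_⟩
    have h := hsad _ (single_mem_stdSimplex ℝ x) _ hz
    have h1 : (choi (A - mix B (Pi.single x 1)) * T).trace.re
        = (choi A * T).trace.re - (choi (B x) * T).trace.re := by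
      simp [trace_choi_sub_mix_mul, Pi.single_apply]
    linarith
  have hobj : primalObjective A T ((choi A * T).trace.re - v) = v := by
    simp [primalObjective]
  have hweak {r S q} (h : DualFeasible A B r S q) : v ≤ r :=
    hobj ▸ primalObjective_le_of_dualFeasible hB hprimal h
  have hle (q) (hq : q ∈ stdSimplex ℝ X) : v ≤ mixError A B q :=
    let ⟨_, h⟩ := (exists_dualFeasible_iff_mixError_le hA hB hq _).mpr le_rfl
    hweak h
  obtain ⟨S, h1, h2, h3⟩ := exists_dominating (hA.choi_sub_mix_isHermitian hB p)
    fun w hw => hsad p hp w hw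
  have hdual : DualFeasible A B v S p := ⟨h1, h2, h3, hp.1, hp.2.le⟩
  have hiff (q) (hq : q ∈ stdSimplex ℝ X) : mixError A B q = v ↔ ∃ S, DualFeasible A B v S q := by
    rw [exists_dualFeasible_iff_mixError_le hA hB hq, le_antisymm_iff, and_iff_left (hle q hq)]
  refine ⟨v, ⟨⟨p, hp, (hiff p hp).mpr ⟨S, hdual⟩⟩, ?_⟩, ⟨⟨T, ρ, _, hprimal, hobj.symm⟩, ?_⟩,
    ⟨⟨S, p, hdual⟩, ?_⟩, hiff, fun S q h q' hq' hle => (hiff q' hq').mpr ⟨S, h.mono hB hq' hle⟩⟩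
  · rintro _ ⟨q, hq, rfl⟩
    exact hle q hq
  · rintro _ ⟨T', ρ', t, h, rfl⟩
    exact primalObjective_le_of_dualFeasible hB h hdual
  · rintro r ⟨S', q, h⟩
    exact hweak h
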